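/- Let $k$ be a field and let $y,z,t_1,t_2,\dots$ be independent indeterminates over $k$. Let $S$ be the monoid of all monomials $f$ of $k[y,z,t_1,t_2,\dots]$ such that $\deg_{y,z} f\ge \deg_{t_n} f$ for all $n\ge 1$ (where $\deg_{y,z}f$ is the total degree of $f$ in $y$ and $z$), let $R=k[S]$ be the $k$-subalgebra of $k[y,z,t_1,t_2,\dots]$ generated by $S$, let $K$ be the field of fractions of $R$, and let $X$ be an indeterminate over $R$. Put $$P=(y+zX)K[X]\cap R[X],\qquad Q=(y,z)\,k[y,z,t_1,t_2,\dots]\cap R .$$ Terminology, for an integral domain $D$ with field of fractions $L$: for a nonzero fractional ideal $I$ of $D$ put $(D:I)=\{x\in L : xI\subseteq D\}$, $I_v=(D:(D:I))$ and $I_t=\bigcup J_v$, the union over all nonzero finitely generated fractional ideals $J\subseteq I$. A nonzero fractional ideal $I$ is divisorial if $I=I_v$, a $t$-ideal if $I=I_t$, and $v$-invertible if $(I(D:I))_v=D$. A maximal divisorial (respectively $t$-maximal) ideal of $D$ is a maximal element of the set of divisorial ideals (respectively $t$-ideals) properly contained in $D$. An upper to zero of $D[X]$ is a nonzero prime ideal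 of $D[X]$ whose intersection with $D$ is $(0)$. The domain $D$ is completely integrally closed if every $s\in L$ for which there is a nonzero $r\in D$ with $rs^n\in D$ for all $n\ge 0$ lies in $D$. Then: 1. $R$ and $R[X]$ are completely integrally closed. 2. $P$ is an upper to zero of $R[X]$ that is $v$-invertible and a maximal divisorial ideal of $R[X]$. 3. $P$ is not $t$-maximal; indeed $QR[X]$ is a proper $t$-ideal of $R[X]$ and $P\subsetneq QR[X]$. -/

import Mathlib

open scoped nonZeroDivisors Polynomial

/-! ### Divisorial ideals and `t`-ideals of an integral domain -/

namespace StarIdeals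

variable {D : Type*} [CommRing D] [IsDomain D]

/-- An integral ideal of `D`, viewed as a fractional ideal. -/
noncomputable abbrev frac (I : Ideal D) : FractionalIdeal D⁰ (FractionRing D) := I

/-- The `v`-closure `I_v = (D : (D : I))` of a nonzero fractional ideal `I` of the domain `D`,
where `(D : I) = {x in the fraction field | x I ⊆ D}`.
(On nonzero fractional ideals `1 / I` is exactly `(D : I)`; every notion below is
restricted to nonzero `I`.) -/
noncomputable def vClosure (I : FractionalIdeal D⁰ (FractionRing D)) :
    FractionalIdeal D⁰ (FractionRing D) :=
  1 / (1 / I)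

/-- The `t`-closure `I_t`: the union of the `J_v`, over all nonzero finitely generated
fractional ideals `J` contained in `I`. -/
def tClosure (I : FractionalIdeal D⁰ (FractionRing D)) : Set (FractionRing D) :=
  {x | ∃ J : FractionalIdeal D⁰ (FractionRing D),
    J ≠ 0 ∧ (J : Submodule D (FractionRing D)).FG ∧ J ≤ I ∧ x ∈ vClosure J}

/-- `I` is divisorial (a `v`-ideal): `I` is nonzero and `I = I_v`. -/
def IsDivisorial (I : FractionalIdeal D⁰ (FractionRing D)) : Prop :=
  I ≠ 0 ∧ vClosure I = I

/-- `I` is a `t`-ideal: `I` is nonzero and `I = I_t`. -/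
def IsTIdeal (I : FractionalIdeal D⁰ (FractionRing D)) : Prop :=
  I ≠ 0 ∧ tClosure I = {x | x ∈ I}

/-- `I` is `v`-invertible: `I` is nonzero and `(I (D : I))_v = D`. -/
def IsVInvertible (I : FractionalIdeal D⁰ (FractionRing D)) : Prop :=
  I ≠ 0 ∧ vClosure (I * (1 / I)) = 1

/-- A maximal divisorial (`v`-maximal) ideal of `D`: maximal among the proper integral
divisorial ideals. -/
def IsMaximalDivisorial (M : Ideal D) : Prop :=
  Maximal (fun J : Ideal D =>
    J ≠ ⊤ ∧ IsDivisorial (frac J)) M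

/-- A `t`-maximal ideal of `D`: maximal among the proper integral `t`-ideals. -/
def IsTMaximal (M : Ideal D) : Prop :=
  Maximal (fun J : Ideal D =>
    J ≠ ⊤ ∧ IsTIdeal (frac J)) M

/-- An upper to zero of `D[X]`: a nonzero prime ideal of `D[X]` that meets `D` in `0`. -/
def IsUpperToZero (P : Ideal D[X]) : Prop :=
  P.IsPrime ∧ P ≠ ⊥ ∧ P.comap Polynomial.C = ⊥

variable (D) in
/-- `D` is completely integrally closed: an element `s` of the fraction field for which there
is a nonzero `r` in `D` with `r s ^ n ∈ D` for all `n` lies in `D`. -/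
def IsCompletelyIntegrallyClosed : Prop :=
  completeIntegralClosure D (FractionRing D) = ⊥

end StarIdeals

/-! ### The monomial ring -/

namespace MonomialExample

/-- The indeterminates `y`, `z` and `t_n` (the index set of the `t_n` is `{1, 2, …}`). -/
inductive Var : Type
  | y : Var
  | z : Var
  | t : ℕ+ → Var

variable (k : Type*) [Field k]

/-- The monoid `S` of monomials `f` of `k[y, z, t]` with `deg_{y,z} f ≥ deg_{t_n} f` for all `n`. -/
noncomputable def S : Submonoid (MvPolynomial Var k) where
  carrier := {f | ∃ m : Var →₀ ℕ,
    (∀ n : ℕ+, m (Var.t n) ≤ m Var.y + m Var.z) ∧ f = MvPolynomial.monomial m 1}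
  one_mem' := ⟨0, by simp, rfl⟩
  mul_mem' := by
    rintro _ _ ⟨m, hm, rfl⟩ ⟨m', hm', rfl⟩
    refine ⟨m + m', fun n => ?_, by simp [MvPolynomial.monomial_mul]⟩
    have h₁ := hm n
    have h₂ := hm' n
    simp only [Finsupp.add_apply]
    omega

/-- The ring `R = k[S]`, as the `k`-subalgebra of `k[y, z, t]` generated by `S`. -/
noncomputable abbrev R : Subalgebra k (MvPolynomial Var k) :=
  Algebra.adjoin k (S k : Set (MvPolynomial Var k))

/-- `y` as an element of `R`. -/
noncomputable def yR : R k :=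
  ⟨MvPolynomial.X Var.y, Algebra.subset_adjoin
    ⟨Finsupp.single Var.y 1, fun n => by simp, rfl⟩⟩

/-- `z` as an element of `R`. -/
noncomputable def zR : R k :=
  ⟨MvPolynomial.X Var.z, Algebra.subset_adjoin
    ⟨Finsupp.single Var.z 1, fun n => by simp, rfl⟩⟩

/-- The ideal `P = (y + z X) K[X] ∩ R[X]` of `R[X]`, where `K` is the fraction field of `R`. -/
noncomputable def P : Ideal (R k)[X] :=
  (Ideal.span {(Polynomial.C (yR k) + Polynomial.C (zR k) * Polynomial.X).map
      (algebraMap (R k) (FractionRing (R k)))}).comap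
    (Polynomial.mapRingHom (algebraMap (R k) (FractionRing (R k))))

/-- The ideal `Q = (y, z) k[y, z, t] ∩ R` of `R`. -/
noncomputable def Q : Ideal (R k) :=
  (Ideal.span {MvPolynomial.X Var.y, MvPolynomial.X Var.z}).comap
    (algebraMap (R k) (MvPolynomial Var k))

/-- The ideal `Q R[X]` of `R[X]`. -/
noncomputable def QRX : Ideal (R k)[X] :=
  (Q k).map Polynomial.C

end MonomialExample

/-!
For each `n`, the least value `v_n` of `deg_{y,z} - deg_{t_n}` on the monomials of a polynomial is
a valuation of `k[y, z, t]` with values in `ℤ`, and `R` is the subring where all `v_n` are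
nonnegative. As `k[y, z, t]` is factorial and `ℤ` is archimedean, `R` is completely integrally
closed, and then so is `R[X]`. In such a domain every nonzero ideal is `v`-invertible, and a
`v`-invertible divisorial prime is maximal divisorial.

Since `v_n y = v_n z` for all `n`, an element `f` of `k[y, z, t]` with `y f ∈ R` has `z f ∈ R`. This
gives `P = (y + z X : z)`, so `P` is divisorial. On the other hand, finitely many elements of `Q`
involve only finitely many of the `t_n`; for any other `n` they lie in the divisorial ideal
`(y : y t_n) = {f ∈ R | v_n f ≥ 1} ⊆ Q`. Hence `QR[X]` is a `t`-ideal, and it strictly contains `P`.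
-/

namespace StarIdeals

theorem IsCompletelyIntegrallyClosed.mem_range_of_isAlmostIntegral {D : Type*} [CommRing D]
    (hD : IsCompletelyIntegrallyClosed D) {x : FractionRing D} (hx : IsAlmostIntegral D x) :
    x ∈ (algebraMap D (FractionRing D)).range := by
  rw [← mem_completeIntegralClosure, show completeIntegralClosure D _ = ⊥ from hD] at hx
  exact hx

variable {D : Type*} [CommRing D] [IsDomain D]

section FractionalIdeal

variable {K : Type*} [Field K] [Algebra D K] [IsFractionRing D K]

theorem mul_inv_ne_zero {I : FractionalIdeal D⁰ K} (hI : I ≠ 0) : I * I⁻¹ ≠ 0 :=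
  (FractionalIdeal.bot_lt_mul_inv hI).ne'

theorem inv_ne_zero {I : FractionalIdeal D⁰ K} (hI : I ≠ 0) : I⁻¹ ≠ 0 :=
  right_ne_zero_of_mul (mul_inv_ne_zero hI)

theorem le_inv_iff_mul_le {I J : FractionalIdeal D⁰ K} (hJ : J ≠ 0) : I ≤ J⁻¹ ↔ I * J ≤ 1 :=
  FractionalIdeal.le_div_iff_mul_le hJ

theorem le_inv_inv {I : FractionalIdeal D⁰ K} (hI : I ≠ 0) : I ≤ I⁻¹⁻¹ :=
  (le_inv_iff_mul_le (inv_ne_zero hI)).mpr FractionalIdeal.mul_one_div_le_one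

theorem inv_inv_inv {I : FractionalIdeal D⁰ K} (hI : I ≠ 0) : I⁻¹⁻¹⁻¹ = I⁻¹ :=
  le_antisymm
    (FractionalIdeal.inv_anti_mono hI (inv_ne_zero (inv_ne_zero hI)) (le_inv_inv hI))
    (le_inv_inv (inv_ne_zero hI))

theorem mem_inv_one_sup_spanSingleton {x y : K} :
    y ∈ (1 ⊔ FractionalIdeal.spanSingleton D⁰ x)⁻¹ ↔
      y ∈ (1 : FractionalIdeal D⁰ K) ∧ y * x ∈ (1 : FractionalIdeal D⁰ K) := by
  have hne : (1 : FractionalIdeal D⁰ K) ⊔ FractionalIdeal.spanSingleton D⁰ x ≠ 0 :=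
    (zero_lt_one.trans_le le_sup_left).ne'
  rw [← FractionalIdeal.spanSingleton_le_iff_mem, le_inv_iff_mul_le hne,
    FractionalIdeal.sup_eq_add, mul_add, mul_one, FractionalIdeal.spanSingleton_mul_spanSingleton,
    ← FractionalIdeal.sup_eq_add, sup_le_iff]
  simp only [FractionalIdeal.spanSingleton_le_iff_mem]

end FractionalIdeal

local notation "L" => FractionRing D

theorem vClosure_eq_inv_inv (I : FractionalIdeal D⁰ L) : vClosure I = I⁻¹⁻¹ := rfl

theorem vClosure_mono {I J : FractionalIdeal D⁰ L} (hI : I ≠ 0) (hIJ : I ≤ J) :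
    vClosure I ≤ vClosure J := by
  have hJ : J ≠ 0 := fun hJ => hI (FractionalIdeal.le_zero_iff.mp (hJ ▸ hIJ))
  exact FractionalIdeal.inv_anti_mono (inv_ne_zero hJ) (inv_ne_zero hI)
    (FractionalIdeal.inv_anti_mono hI hJ hIJ)

theorem isDivisorial_inv {I : FractionalIdeal D⁰ L} (hI : I ≠ 0) : IsDivisorial I⁻¹ :=
  ⟨inv_ne_zero hI, inv_inv_inv hI⟩

theorem isDivisorial_colon_span_singleton {a b : D} (hb : b ≠ 0) :
    IsDivisorial (frac ((Ideal.span {b}).colon {a})) := by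
  have hb' : algebraMap D L b ≠ 0 := by simpa using hb
  have heq : frac ((Ideal.span {b}).colon {a}) =
      (1 ⊔ FractionalIdeal.spanSingleton D⁰ (algebraMap D L a / algebraMap D L b))⁻¹ := by
    ext x
    rw [mem_inv_one_sup_spanSingleton, FractionalIdeal.mem_one_iff, FractionalIdeal.mem_one_iff,
      FractionalIdeal.mem_coeIdeal, ← exists_and_right]
    refine exists_congr fun g => ?_
    rw [Submodule.mem_colon_singleton, smul_eq_mul, Ideal.mem_span_singleton, and_comm]
    refine and_congr_right fun hx => exists_congr fun c => ?_
    rw [← hx, mul_div_assoc', eq_div_iff hb', ← map_mul, ← map_mul,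
      (FaithfulSMul.algebraMap_injective D L).eq_iff, eq_comm, mul_comm b]
  rw [heq]
  exact isDivisorial_inv (zero_lt_one.trans_le le_sup_left).ne'

theorem isTIdeal_of_fg_le_isDivisorial {I : Ideal D} (hI : I ≠ ⊥)
    (h : ∀ J : Ideal D, J.FG → J ≤ I → ∃ A : Ideal D, IsDivisorial (frac A) ∧ J ≤ A ∧ A ≤ I) :
    IsTIdeal (frac I) := by
  have hfrac {A B : Ideal D} : frac A ≤ frac B ↔ A ≤ B := FractionalIdeal.coeIdeal_le_coeIdeal L
  have hI0 : frac I ≠ 0 := FractionalIdeal.coeIdeal_ne_zero.mpr hI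
  refine ⟨hI0, Set.Subset.antisymm ?_ fun x hx => ?_⟩
  · rintro x ⟨J, hJ0, hJfg, hJI, hx⟩
    obtain ⟨J, rfl⟩ :=
      FractionalIdeal.le_one_iff_exists_coeIdeal.mp (hJI.trans FractionalIdeal.coeIdeal_le_one)
    rw [FractionalIdeal.coeIdeal_fg _ (FaithfulSMul.algebraMap_injective D L)] at hJfg
    obtain ⟨A, hA, hJA, hAI⟩ := h J hJfg (hfrac.mp hJI)
    exact hfrac.mpr hAI (hA.2 ▸ vClosure_mono hJ0 (hfrac.mpr hJA) hx)
  · obtain ⟨c, hc, hc0⟩ := Submodule.exists_mem_ne_zero_of_ne_bot hI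
    obtain ⟨g, hg, rfl⟩ := (FractionalIdeal.mem_coeIdeal _).mp hx
    have hle : Ideal.span {g, c} ≤ I := Ideal.span_le.mpr (Set.pair_subset hg hc)
    have hne : frac (Ideal.span {g, c}) ≠ 0 := FractionalIdeal.coeIdeal_ne_zero.mpr fun hbot =>
      hc0 (Ideal.span_eq_bot.mp hbot c (by simp))
    refine ⟨_, hne, ?_, hfrac.mpr hle,
      le_inv_inv hne (FractionalIdeal.mem_coeIdeal_of_mem _ (Ideal.subset_span (by simp)))⟩
    rw [FractionalIdeal.coeIdeal_fg _ (FaithfulSMul.algebraMap_injective D L)]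
    exact Submodule.fg_span (Set.toFinite _)

theorem IsVInvertible.le_one_of_mul_le_self {I J : FractionalIdeal D⁰ L} (hI : IsVInvertible I)
    (hJ : J * I ≤ I) : J ≤ 1 := by
  have hne := mul_inv_ne_zero hI.1
  have hinv : (I * I⁻¹)⁻¹ = 1 := calc
    (I * I⁻¹)⁻¹ = (vClosure (I * I⁻¹))⁻¹ := (inv_inv_inv hne).symm
    _ = 1 := by rw [show vClosure (I * I⁻¹) = 1 from hI.2, inv_one]
  rw [← hinv, le_inv_iff_mul_le hne, ← mul_assoc]
  exact (mul_le_mul_left hJ _).trans FractionalIdeal.mul_one_div_le_one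

theorem inv_mul_le_of_isPrime {P J : Ideal D} (hP : P.IsPrime) (hJ : J ≠ ⊥) (hPJ : P < J) :
    (frac J)⁻¹ * frac P ≤ frac P := by
  have hJ0 : frac J ≠ 0 := FractionalIdeal.coeIdeal_ne_zero.mpr hJ
  obtain ⟨b, hbJ, hbP⟩ := SetLike.exists_of_lt hPJ
  refine FractionalIdeal.mul_le.mpr fun x hx p' hp' => ?_
  obtain ⟨p, hp, rfl⟩ := (FractionalIdeal.mem_coeIdeal _).mp hp'
  have hxJ {j : D} (hj : j ∈ J) : ∃ c, algebraMap D L c = x * algebraMap D L j :=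
    (FractionalIdeal.mem_one_iff _).mp
      ((FractionalIdeal.mem_inv_iff hJ0).mp hx _ (FractionalIdeal.mem_coeIdeal_of_mem _ hj))
  obtain ⟨c, hc⟩ := hxJ (hPJ.le hp)
  obtain ⟨d, hd⟩ := hxJ hbJ
  have hcb : c * b = d * p := by
    apply FaithfulSMul.algebraMap_injective D L
    rw [map_mul, map_mul, hc, hd, mul_right_comm]
  rw [← hc]
  exact FractionalIdeal.mem_coeIdeal_of_mem _
    ((hP.mem_or_mem (hcb ▸ P.mul_mem_left d hp)).resolve_right hbP)

theorem IsVInvertible.isMaximalDivisorial {P : Ideal D} (hinv : IsVInvertible (frac P))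
    (hP : P.IsPrime) (hdiv : IsDivisorial (frac P)) : IsMaximalDivisorial P := by
  refine ⟨⟨hP.ne_top, hdiv⟩, fun J ⟨hJtop, hJ0, hJ⟩ hPJ => ?_⟩
  by_contra hJP
  have hJinv : (frac J)⁻¹ ≤ 1 := hinv.le_one_of_mul_le_self
    (inv_mul_le_of_isPrime hP (FractionalIdeal.coeIdeal_ne_zero.mp hJ0) (lt_of_le_not_ge hPJ hJP))
  have hone : 1 ≤ frac J := by
    rw [← hJ, vClosure_eq_inv_inv, le_inv_iff_mul_le (inv_ne_zero hJ0), one_mul]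
    exact hJinv
  exact hJtop ((FractionalIdeal.coeIdeal_eq_one.mp
    (le_antisymm FractionalIdeal.coeIdeal_le_one hone)).trans Ideal.one_eq_top)

theorem isAlmostIntegral_of_mul_mem {K : Type*} [Field K] [Algebra D K] [IsFractionRing D K]
    {I : FractionalIdeal D⁰ K} (hI : I ≠ 0) {x : K} (hx : ∀ y ∈ I, x * y ∈ I) :
    IsAlmostIntegral D x := by
  obtain ⟨c, hc0, hc⟩ := FractionalIdeal.exists_ne_zero_mem_isInteger hI
  have hpow (n : ℕ) : x ^ n * algebraMap D K c ∈ I := by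
    induction n with
    | zero => simpa using hc
    | succ n ih => rw [pow_succ', mul_assoc]; exact hx _ ih
  refine ⟨I.den * c, mul_mem I.den.2 (mem_nonZeroDivisors_of_ne_zero hc0), fun n => ?_⟩
  obtain ⟨d, hd⟩ := (FractionalIdeal.mem_one_iff _).mp
    ((FractionalIdeal.mem_inv_iff hI).mp (FractionalIdeal.den_mem_inv hI) _ (hpow n))
  exact ⟨d, by rw [hd, Algebra.smul_def, map_mul]; ring⟩

theorem IsCompletelyIntegrallyClosed.isVInvertible (hD : IsCompletelyIntegrallyClosed D)
    {I : FractionalIdeal D⁰ L} (hI : I ≠ 0) : IsVInvertible I := by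
  have hne := mul_inv_ne_zero hI
  suffices hinv : (I * I⁻¹)⁻¹ = 1 by
    refine ⟨hI, ?_⟩
    rw [vClosure_eq_inv_inv, ← FractionalIdeal.inv_eq, hinv, inv_one]
  refine le_antisymm (fun x hx => ?_) ?_
  · refine (FractionalIdeal.mem_one_iff _).mpr (hD.mem_range_of_isAlmostIntegral
      (isAlmostIntegral_of_mul_mem (inv_ne_zero hI) fun b hb => ?_))
    refine (FractionalIdeal.mem_inv_iff hI).mpr fun a ha => ?_
    rw [mul_assoc, mul_comm b]
    exact (FractionalIdeal.mem_inv_iff hne).mp hx _ (FractionalIdeal.mul_mem_mul ha hb)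
  · rw [le_inv_iff_mul_le hne, one_mul]
    exact FractionalIdeal.mul_one_div_le_one

theorem isCompletelyIntegrallyClosed_of_uniqueFactorizationMonoid [UniqueFactorizationMonoid D] :
    IsCompletelyIntegrallyClosed D := by
  refine eq_bot_iff.mpr ?_
  rintro s ⟨r, hr, hs⟩
  set p := IsFractionRing.num D s
  set q : D := (IsFractionRing.den D s : D)
  have hq0 : algebraMap D L q ≠ 0 := by simp [q]
  have hsq : algebraMap D L p = s * algebraMap D L q :=
    (div_eq_iff hq0).mp (IsFractionRing.mk'_num_den' D s)
  have hpq : IsRelPrime p q := IsFractionRing.num_den_reduced D s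
  have hdvd (n : ℕ) : q ^ n ∣ r := by
    obtain ⟨d, hd⟩ := hs n
    have : q ^ n ∣ r * p ^ n := by
      refine ⟨d, FaithfulSMul.algebraMap_injective D L ?_⟩
      rw [map_mul, map_mul, hd, map_pow, map_pow, hsq, Algebra.smul_def]
      ring
    exact hpq.symm.pow_left.pow_right.dvd_of_dvd_mul_right this
  have hunit : IsUnit q := by
    by_contra hq
    obtain ⟨n, hn⟩ := FiniteMultiplicity.of_not_isUnit hq (nonZeroDivisors.ne_zero hr)
    exact hn (hdvd _)
  exact IsFractionRing.isInteger_of_isUnit_den hunit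

theorem IsCompletelyIntegrallyClosed.of_extension {U : Type*} [CommRing U] [IsDomain U]
    [Algebra D U] [FaithfulSMul D U] (hU : IsCompletelyIntegrallyClosed U)
    (h : completeIntegralClosure D U = ⊥) : IsCompletelyIntegrallyClosed D := by
  have hinj : Function.Injective (algebraMap U (FractionRing U)) :=
    FaithfulSMul.algebraMap_injective _ _
  let φ : L →+* FractionRing U := IsFractionRing.map (FaithfulSMul.algebraMap_injective D U)
  have hφ (d : D) : φ (algebraMap D L d) = algebraMap U (FractionRing U) (algebraMap D U d) :=
    IsLocalization.map_eq _ d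
  refine eq_bot_iff.mpr ?_
  rintro s ⟨r, hr, hs⟩
  have hφs (n : ℕ) : ∃ d, algebraMap U (FractionRing U) (algebraMap D U d) =
      algebraMap U (FractionRing U) (algebraMap D U r) * φ s ^ n := by
    obtain ⟨d, hd⟩ := hs n
    exact ⟨d, by rw [← hφ, hd, Algebra.smul_def, map_mul, map_pow, hφ]⟩
  obtain ⟨u, hu⟩ : φ s ∈ (algebraMap U (FractionRing U)).range := by
    refine hU.mem_range_of_isAlmostIntegral ⟨algebraMap D U r, ?_, fun n => ?_⟩
    · simpa using hr
    · obtain ⟨d, hd⟩ := hφs n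
      exact ⟨algebraMap D U d, by rw [hd, Algebra.smul_def]⟩
  have hmem : u ∈ completeIntegralClosure D U := by
    refine ⟨r, hr, fun n => ?_⟩
    obtain ⟨d, hd⟩ := hφs n
    exact ⟨d, hinj (by rw [hd, Algebra.smul_def, map_mul, map_pow, hu])⟩
  obtain ⟨d, rfl⟩ := Algebra.mem_bot.mp (h ▸ hmem)
  exact Algebra.mem_bot.mpr ⟨d, φ.injective (by rw [hφ, hu])⟩

attribute [local instance] Polynomial.algebra in
theorem IsCompletelyIntegrallyClosed.polynomial (hD : IsCompletelyIntegrallyClosed D) :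
    IsCompletelyIntegrallyClosed D[X] := by
  have : FaithfulSMul D[X] L[X] := (faithfulSMul_iff_algebraMap_injective _ _).mpr
    (Polynomial.map_injective _ (FaithfulSMul.algebraMap_injective D L))
  refine isCompletelyIntegrallyClosed_of_uniqueFactorizationMonoid.of_extension
    (U := L[X]) (eq_bot_iff.mpr fun f hf => ?_)
  have hlifts : f ∈ Polynomial.lifts (algebraMap D L) :=
    (Polynomial.lifts_iff_coeff_lifts f).mpr fun i =>
      hD.mem_range_of_isAlmostIntegral (IsAlmostIntegral.coeff hf i)
  exact (Polynomial.mem_lifts _).mp hlifts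

end StarIdeals

namespace StarIdeals

open Polynomial

variable {D : Type*} [CommRing D]

theorem map_C_colon_span_singleton {a b : D} :
    ((Ideal.span {b}).colon {a}).map C = (Ideal.span {C b}).colon {C a} := by
  ext f
  simp only [Ideal.mem_map_C_iff, Submodule.mem_colon_singleton, smul_eq_mul,
    Ideal.mem_span_singleton, C_dvd_iff_dvd_coeff, coeff_mul_C]

theorem exists_fg_le_map {E : Type*} [CommRing E] (φ : D →+* E) {I : Ideal D} {J : Ideal E}
    (hfg : J.FG) (hJ : J ≤ I.map φ) : ∃ J₀ : Ideal D, J₀.FG ∧ J₀ ≤ I ∧ J ≤ J₀.map φ := by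
  classical
  obtain ⟨s, rfl⟩ := hfg
  obtain ⟨T, hTI, hT⟩ := Submodule.subset_span_finite_of_subset_span
    (t := s) (s := φ '' I) (Submodule.span_le.mp hJ)
  obtain ⟨T₀, hT₀, rfl⟩ := Finset.subset_set_image_iff.mp hTI
  refine ⟨Ideal.span T₀, ⟨T₀, rfl⟩, Ideal.span_le.mpr hT₀, ?_⟩
  rw [Ideal.map_span, ← Finset.coe_image]
  exact Submodule.span_le.mpr hT

theorem mem_lifts_C_mul_of_linear_mul_mem_lifts {E : Type*} [CommRing E] {φ : D →+* E} {a b : E}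
    (h : ∀ u, a * u ∈ φ.range → b * u ∈ φ.range) {p : E[X]}
    (hp : (C a + C b * X) * p ∈ lifts φ) : C b * p ∈ lifts φ := by
  have hcoeff (i : ℕ) : ((C a + C b * X) * p).coeff i ∈ φ.range :=
    (lifts_iff_coeff_lifts _).mp hp i
  refine (lifts_iff_coeff_lifts _).mpr fun i => ?_
  rw [coeff_C_mul]
  refine h _ ?_
  induction i with
  | zero => simpa [add_mul, mul_assoc] using hcoeff 0
  | succ i ih =>
    have hsucc : a * p.coeff (i + 1) + b * p.coeff i ∈ φ.range := by
      simpa [add_mul, mul_assoc] using hcoeff (i + 1)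
    simpa using sub_mem hsucc (h _ ih)

variable [IsDomain D]

section FractionField

variable {K : Type*} [Field K] [Algebra D K] [IsFractionRing D K]

theorem map_dvd_map_iff_exists_dvd_C_mul {f g : D[X]} :
    f.map (algebraMap D K) ∣ g.map (algebraMap D K) ↔ ∃ b : D, b ≠ 0 ∧ f ∣ C b * g := by
  have hinj := FaithfulSMul.algebraMap_injective D K
  constructor
  · rintro ⟨h, hh⟩
    obtain ⟨b, hb, hH⟩ := IsLocalization.integerNormalization_spec D⁰ h
    refine ⟨b, nonZeroDivisors.ne_zero hb, IsLocalization.integerNormalization D⁰ h,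
      map_injective _ hinj ?_⟩
    have hsmul : b • h = C (algebraMap D K b) * h := by
      rw [← smul_eq_C_mul, algebraMap_smul]
    rw [Polynomial.map_mul, Polynomial.map_mul, hH, map_C, hh, hsmul, mul_left_comm]
  · rintro ⟨b, hb, h⟩
    have hu : IsUnit (C (algebraMap D K b)) := isUnit_C.mpr (IsUnit.mk0 _ (by simpa using hb))
    rw [← hu.dvd_mul_left, ← map_C, ← Polynomial.map_mul]
    exact Polynomial.map_dvd _ h

theorem isUpperToZero_comap_span_singleton {f : K[X]} (hf : Irreducible f) :
    IsUpperToZero ((Ideal.span {f}).comap (mapRingHom (algebraMap D K))) := by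
  have hprime := (Ideal.span_singleton_prime hf.ne_zero).mpr hf.prime
  refine ⟨Ideal.comap_isPrime _ _, fun hbot => ?_, eq_bot_iff.mpr fun a ha => ?_⟩
  · obtain ⟨b, hb, hF⟩ := IsLocalization.integerNormalization_spec D⁰ f
    have hmem : IsLocalization.integerNormalization D⁰ f ∈
        (Ideal.span {f}).comap (mapRingHom (algebraMap D K)) := by
      rw [Ideal.mem_comap, coe_mapRingHom, hF]
      exact Submodule.smul_of_tower_mem _ b (Ideal.mem_span_singleton_self f)
    rw [hbot, Ideal.mem_bot] at hmem
    rw [hmem, Polynomial.map_zero, eq_comm, smul_eq_zero] at hF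
    exact hF.elim (nonZeroDivisors.ne_zero hb) hf.ne_zero
  · by_contra ha0
    refine hf.not_isUnit (isUnit_of_dvd_unit (Ideal.mem_span_singleton.mp ha) ?_)
    rw [coe_mapRingHom, map_C]
    exact isUnit_C.mpr (IsUnit.mk0 _ (by simpa using ha0))

theorem map_dvd_map_of_prime {U : Type*} [CommRing U] [IsDomain U] [Algebra D U]
    [FaithfulSMul D U] {f g : D[X]} (hprime : Prime (f.map (algebraMap D U)))
    (hdeg : f.natDegree ≠ 0) (h : f.map (algebraMap D K) ∣ g.map (algebraMap D K)) :
    f.map (algebraMap D U) ∣ g.map (algebraMap D U) := by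
  have hinj := FaithfulSMul.algebraMap_injective D U
  obtain ⟨b, hb, hfg⟩ := map_dvd_map_iff_exists_dvd_C_mul.mp h
  have hdvd := Polynomial.map_dvd (algebraMap D U) hfg
  rw [Polynomial.map_mul, map_C] at hdvd
  refine (hprime.dvd_or_dvd hdvd).resolve_left fun hC => hdeg ?_
  have hle := natDegree_le_of_dvd hC (by simpa using hb)
  rwa [natDegree_C, natDegree_map_eq_of_injective hinj, Nat.le_zero] at hle

theorem comap_span_linear_eq_colon {U : Type*} [CommRing U] [IsDomain U] [Algebra D U]
    [FaithfulSMul D U] {a b : D} (hb : b ≠ 0)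
    (hprime : Prime ((C a + C b * X).map (algebraMap D U)))
    (h : ∀ u : U, algebraMap D U a * u ∈ (algebraMap D U).range →
      algebraMap D U b * u ∈ (algebraMap D U).range) :
    (Ideal.span {(C a + C b * X).map (algebraMap D K)}).comap (mapRingHom (algebraMap D K)) =
      (Ideal.span {C a + C b * X}).colon {C b} := by
  ext g
  rw [Ideal.mem_comap, coe_mapRingHom, Ideal.mem_span_singleton, Submodule.mem_colon_singleton,
    smul_eq_mul, Ideal.mem_span_singleton, mul_comm g]
  refine ⟨fun hg => ?_, fun hg => map_dvd_map_iff_exists_dvd_C_mul.mpr ⟨b, hb, hg⟩⟩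
  have hdeg : (C a + C b * X).natDegree ≠ 0 := by
    rw [add_comm, natDegree_linear hb]; exact one_ne_zero
  obtain ⟨p, hp⟩ := map_dvd_map_of_prime hprime hdeg hg
  have hlift : (C (algebraMap D U a) + C (algebraMap D U b) * X) * p ∈ lifts (algebraMap D U) :=
    (mem_lifts _).mpr ⟨g, by simpa using hp⟩
  obtain ⟨q, hq⟩ := (mem_lifts _).mp (mem_lifts_C_mul_of_linear_mul_mem_lifts h hlift)
  refine ⟨q, map_injective _ (FaithfulSMul.algebraMap_injective D U) ?_⟩
  rw [Polynomial.map_mul, Polynomial.map_mul, hp, hq, map_C, mul_left_comm]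

end FractionField

end StarIdeals

section WeightValuation

open MvPolynomial

variable {σ Γ A : Type*} [CommRing A]

section Grading

variable [AddCommMonoid Γ] [PartialOrder Γ] [IsOrderedCancelAddMonoid Γ]

/-- The homomorphism `X i ↦ X i * T ^ w i` from `A[X i | i]` to Hahn series in `T`, whose
coefficients are the weighted homogeneous components. -/
noncomputable def weightGrading (w : σ → Γ) :
    MvPolynomial σ A →+* HahnSeries Γ (MvPolynomial σ A) :=
  eval₂Hom (HahnSeries.C.comp C) fun i => HahnSeries.single (w i) (X i)

theorem weightGrading_monomial (w : σ → Γ) (m : σ →₀ ℕ) (c : A) :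
    weightGrading w (monomial m c) = HahnSeries.single (Finsupp.weight w m) (monomial m c) := by
  induction m using Finsupp.induction_linear generalizing c with
  | zero => simp [weightGrading, HahnSeries.C_apply]
  | add m m' hm hm' =>
    have hmul : monomial (m + m') c = monomial m c * monomial m' (1 : A) := by
      rw [monomial_mul, mul_one]
    rw [hmul, map_mul, hm, hm', HahnSeries.single_mul_single, map_add]
  | single i e =>
    rw [weightGrading, coe_eval₂Hom, eval₂_monomial, Finsupp.prod_single_index (by simp),
      HahnSeries.single_pow, RingHom.comp_apply, HahnSeries.C_apply, HahnSeries.single_mul_single,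
      zero_add, Finsupp.weight_single, C_mul_X_pow_eq_monomial]

theorem coeff_weightGrading (w : σ → Γ) (f : MvPolynomial σ A) (γ : Γ) :
    (weightGrading w f).coeff γ = weightedHomogeneousComponent w γ f := by
  classical
  induction f using MvPolynomial.induction_on' with
  | monomial m c =>
    rw [weightGrading_monomial, HahnSeries.coeff_single, weightedHomogeneousComponent_of_mem
      (isWeightedHomogeneous_monomial w m c rfl)]
  | add f g hf hg => rw [map_add, HahnSeries.coeff_add, hf, hg, map_add]

end Grading

section Valuation

variable [IsDomain A] [AddCancelCommMonoid Γ] [LinearOrder Γ] [IsOrderedCancelAddMonoid Γ]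

/-- The monomial valuation of `A[X i | i]` with `v (X i) = w i`: the least weight of a monomial
in the support of a polynomial. -/
noncomputable def weightValuation (w : σ → Γ) : AddValuation (MvPolynomial σ A) (WithTop Γ) :=
  (HahnSeries.addVal Γ (MvPolynomial σ A)).comap (weightGrading w)

theorem coe_le_weightValuation_iff {w : σ → Γ} {f : MvPolynomial σ A} {γ : Γ} :
    γ ≤ weightValuation w f ↔ ∀ m ∈ f.support, γ ≤ Finsupp.weight w m := by
  classical
  change γ ≤ HahnSeries.addVal Γ _ (weightGrading w f) ↔ _
  simp only [HahnSeries.addVal_apply, HahnSeries.le_orderTop_iff_forall, WithTop.coe_lt_coe,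
    coeff_weightGrading, MvPolynomial.ext_iff, coeff_weightedHomogeneousComponent, coeff_zero,
    ite_eq_right_iff, mem_support_iff]
  exact ⟨fun h m hm => not_lt.mp fun hlt => hm (h _ hlt m rfl),
    fun h γ' hγ' m hm => by_contra fun hne => (h m hne).not_gt (hm ▸ hγ')⟩

theorem weightValuation_X (w : σ → Γ) (i : σ) :
    weightValuation w (X i : MvPolynomial σ A) = w i := by
  change HahnSeries.addVal Γ _ (weightGrading w (X i)) = _
  rw [X, weightGrading_monomial, HahnSeries.addVal_apply, HahnSeries.orderTop_single,
    Finsupp.weight_single, one_smul]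
  exact X_ne_zero i

theorem weightValuation_ne_top {w : σ → Γ} {f : MvPolynomial σ A} (hf : f ≠ 0) :
    weightValuation w f ≠ ⊤ := by
  classical
  change HahnSeries.addVal Γ _ (weightGrading w f) ≠ ⊤
  obtain ⟨m, hm⟩ := ne_zero_iff.mp hf
  refine ne_top_of_le_ne_top WithTop.coe_ne_top
    (HahnSeries.addVal_le_of_coeff_ne_zero (g := Finsupp.weight w m) fun h => hm ?_)
  rw [coeff_weightGrading] at h
  simpa [coeff_weightedHomogeneousComponent] using congrArg (coeff m) h

end Valuation

end WeightValuation

theorem addValuation_nonneg_of_isAlmostIntegral {D U Γ : Type*} [CommRing D] [CommRing U]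
    [Algebra D U] [AddCommGroup Γ] [LinearOrder Γ] [IsOrderedAddMonoid Γ] [Archimedean Γ]
    (v : AddValuation U (WithTop Γ)) (hv : ∀ d : D, 0 ≤ v (algebraMap D U d))
    (htop : ∀ d ∈ D⁰, v (algebraMap D U d) ≠ ⊤) {u : U} (hu : IsAlmostIntegral D u) :
    0 ≤ v u := by
  obtain ⟨r, hr, hru⟩ := hu
  by_contra! hneg
  obtain ⟨α, hα⟩ := WithTop.ne_top_iff_exists.mp (htop r hr)
  obtain ⟨γ, hγ⟩ := WithTop.ne_top_iff_exists.mp hneg.ne_top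
  rw [← hγ, ← WithTop.coe_zero, WithTop.coe_lt_coe] at hneg
  obtain ⟨n, hn⟩ := exists_lt_nsmul (neg_pos.mpr hneg) α
  obtain ⟨d, hd⟩ := hru n
  have hnonneg : 0 ≤ α + n • γ := by
    have := hv d
    rwa [hd, Algebra.smul_def, v.map_mul, v.map_pow, ← hα, ← hγ, ← WithTop.coe_nsmul,
      ← WithTop.coe_add, ← WithTop.coe_zero, WithTop.coe_le_coe] at this
  rw [smul_neg] at hn
  exact (lt_neg_iff_add_neg.mp hn).not_ge hnonneg

namespace MonomialExample

open MvPolynomial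

variable {k : Type*} [Field k]

section Excess

/-- The weights with `Finsupp.weight (excessWeight n) m = deg_{y,z} m - deg_{t_n} m`. -/
def excessWeight (n : ℕ+) : Var → ℤ
  | Var.y => 1
  | Var.z => 1
  | Var.t j => if j = n then -1 else 0

theorem weight_excessWeight (n : ℕ+) (m : Var →₀ ℕ) :
    Finsupp.weight (excessWeight n) m = m Var.y + m Var.z - m (Var.t n) := by
  induction m using Finsupp.induction_linear with
  | zero => simp
  | add m m' hm hm' => rw [map_add, hm, hm']; push_cast [Finsupp.add_apply]; ring
  | single v e =>
    classical
    rw [Finsupp.weight_single]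
    cases v <;> simp [excessWeight, Finsupp.single_apply, apply_ite Neg.neg]

/-- The valuation of `k[y, z, t]` given by the least value of `deg_{y,z} - deg_{t_n}` on the
monomials of a polynomial. -/
noncomputable def excess (n : ℕ+) : AddValuation (MvPolynomial Var k) (WithTop ℤ) :=
  weightValuation (excessWeight n)

theorem coe_le_excess_iff {n : ℕ+} {f : MvPolynomial Var k} {c : ℤ} :
    c ≤ excess n f ↔ ∀ m ∈ f.support, c ≤ m Var.y + m Var.z - m (Var.t n) := by
  simp only [excess, coe_le_weightValuation_iff, weight_excessWeight]

theorem mem_R_iff_excess_nonneg {f : MvPolynomial Var k} : f ∈ R k ↔ ∀ n, 0 ≤ excess n f := by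
  have hS : (S k : Set (MvPolynomial Var k)) = (monomial · 1) ''
      {m : Var →₀ ℕ | ∀ n : ℕ+, m (Var.t n) ≤ m Var.y + m Var.z} := by
    ext f
    simp [S, eq_comm]
  rw [← Subalgebra.mem_toSubmodule, Algebra.adjoin_eq_span, Submonoid.closure_eq, hS,
    ← restrictSupport_eq_span, mem_restrictSupport_iff]
  simp only [← WithTop.coe_zero, coe_le_excess_iff, sub_nonneg]
  norm_cast
  exact ⟨fun h n m hm => h hm n, fun h m hm n => h n m hm⟩

theorem isCompletelyIntegrallyClosed_R : StarIdeals.IsCompletelyIntegrallyClosed (R k) := by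
  refine StarIdeals.isCompletelyIntegrallyClosed_of_uniqueFactorizationMonoid.of_extension
    (U := MvPolynomial Var k) (eq_bot_iff.mpr fun f hf => Algebra.mem_bot.mpr ?_)
  have hfR : f ∈ R k := mem_R_iff_excess_nonneg.mpr fun n =>
    addValuation_nonneg_of_isAlmostIntegral (excess n) (fun d => mem_R_iff_excess_nonneg.mp d.2 n)
      (fun d hd => weightValuation_ne_top (by simpa using nonZeroDivisors.ne_zero hd)) hf
  exact ⟨⟨f, hfR⟩, rfl⟩

end Excess

section UpperToZero

theorem zR_ne_zero : zR k ≠ 0 := fun h => X_ne_zero Var.z (congrArg Subtype.val h)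

theorem yR_ne_zero : yR k ≠ 0 := fun h => X_ne_zero Var.y (congrArg Subtype.val h)

theorem z_mul_mem_R_of_y_mul_mem_R {f : MvPolynomial Var k} (h : X Var.y * f ∈ R k) :
    X Var.z * f ∈ R k := by
  have hyz (n : ℕ+) : excess n (X Var.z : MvPolynomial Var k) =
      excess n (X Var.y : MvPolynomial Var k) := by
    simp only [excess, weightValuation_X, excessWeight]
  simpa only [mem_R_iff_excess_nonneg, AddValuation.map_mul, hyz] using h

variable (k) in
/-- The polynomial `y + z X` over `R`. -/
noncomputable def linearPoly : (R k)[X] :=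
  Polynomial.C (yR k) + Polynomial.C (zR k) * Polynomial.X

theorem natDegree_linearPoly : (linearPoly k).natDegree = 1 := by
  rw [linearPoly, add_comm, Polynomial.natDegree_linear zR_ne_zero]

theorem map_linearPoly : (linearPoly k).map (algebraMap (R k) (MvPolynomial Var k)) =
    Polynomial.C (X Var.y) + Polynomial.C (X Var.z) * Polynomial.X := by
  simp [linearPoly, yR, zR]

theorem prime_map_linearPoly :
    Prime ((linearPoly k).map (algebraMap (R k) (MvPolynomial Var k))) := by
  rw [map_linearPoly, ← UniqueFactorizationMonoid.irreducible_iff_prime, add_comm]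
  refine Polynomial.irreducible_C_mul_X_add_C (X_ne_zero _) ?_
  rw [(X_prime (i := Var.z)).irreducible.isRelPrime_iff_not_dvd, X_dvd_X]
  simp

theorem isUpperToZero_P : StarIdeals.IsUpperToZero (P k) := by
  refine StarIdeals.isUpperToZero_comap_span_singleton
    (Polynomial.irreducible_of_degree_eq_one ?_)
  rw [Polynomial.degree_map_eq_of_injective (IsFractionRing.injective (R k) _)]
  exact (Polynomial.degree_eq_iff_natDegree_eq_of_pos one_pos).mpr natDegree_linearPoly

theorem P_eq_colon :
    P k = (Ideal.span {linearPoly k}).colon {Polynomial.C (zR k)} := by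
  refine StarIdeals.comap_span_linear_eq_colon zR_ne_zero prime_map_linearPoly ?_
  rintro u ⟨f, hf⟩
  exact ⟨⟨_, z_mul_mem_R_of_y_mul_mem_R (hf ▸ f.2)⟩, rfl⟩

theorem isDivisorial_P : StarIdeals.IsDivisorial (StarIdeals.frac (D := (R k)[X]) (P k)) := by
  rw [P_eq_colon]
  refine StarIdeals.isDivisorial_colon_span_singleton fun h => ?_
  simpa [h] using natDegree_linearPoly (k := k)

end UpperToZero

section TIdeal

theorem t_mul_mem_R_iff {n : ℕ+} (f : R k) :
    X (Var.t n) * (f : MvPolynomial Var k) ∈ R k ↔ 1 ≤ excess n (f : MvPolynomial Var k) := by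
  have hf := mem_R_iff_excess_nonneg.mp f.2
  have ht (j : ℕ+) : excess j (X (Var.t n) : MvPolynomial Var k) =
      ((if n = j then -1 else 0 : ℤ) : WithTop ℤ) := by
    rw [excess, weightValuation_X, excessWeight]
  have hshift (e : WithTop ℤ) : 0 ≤ ((-1 : ℤ) : WithTop ℤ) + e ↔ 1 ≤ e := by
    induction e using WithTop.recTopCoe with
    | top => simp
    | coe e => norm_cast; omega
  simp only [mem_R_iff_excess_nonneg, AddValuation.map_mul, ht]
  refine ⟨fun h => (hshift _).mp (by simpa using h n), fun h j => ?_⟩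
  split_ifs with hj
  · exact (hshift _).mpr (hj ▸ h)
  · simpa using hf j

variable (k) in
/-- The monomial `y t_n` as an element of `R`. -/
noncomputable def ytR (n : ℕ+) : R k :=
  ⟨X (Var.t n) * X Var.y, (t_mul_mem_R_iff (yR k)).mpr
    (by rw [yR, excess, weightValuation_X]; rfl)⟩

variable (k) in
/-- The ideal `(y : y t_n) = R ∩ t_n⁻¹ R`, the center on `R` of the valuation `excess n`. -/
noncomputable def center (n : ℕ+) : Ideal (R k) :=
  (Ideal.span {yR k}).colon {ytR k n}

theorem mem_center_iff {n : ℕ+} {f : R k} :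
    f ∈ center k n ↔ 1 ≤ excess n (f : MvPolynomial Var k) := by
  rw [center, Submodule.mem_colon_singleton, smul_eq_mul, Ideal.mem_span_singleton,
    ← t_mul_mem_R_iff]
  have hcomm : ((f * ytR k n : R k) : MvPolynomial Var k) =
      X Var.y * (X (Var.t n) * (f : MvPolynomial Var k)) := by
    change (f : MvPolynomial Var k) * (X (Var.t n) * X Var.y) = _
    ring
  constructor
  · rintro ⟨c, hc⟩
    have hyc : X Var.y * (X (Var.t n) * (f : MvPolynomial Var k)) =
        X Var.y * (c : MvPolynomial Var k) := by
      rw [← hcomm, hc]; rfl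
    exact mul_left_cancel₀ (X_ne_zero _) hyc ▸ c.2
  · exact fun h => ⟨⟨_, h⟩, Subtype.ext hcomm⟩

theorem isDivisorial_map_C_center (n : ℕ+) :
    StarIdeals.IsDivisorial (StarIdeals.frac ((center k n).map Polynomial.C)) := by
  rw [center, StarIdeals.map_C_colon_span_singleton]
  exact StarIdeals.isDivisorial_colon_span_singleton (Polynomial.C_ne_zero.mpr yR_ne_zero)

theorem mem_Q_iff {f : R k} :
    f ∈ Q k ↔ ∀ m ∈ (f : MvPolynomial Var k).support, 1 ≤ m Var.y + m Var.z := by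
  rw [Q, Ideal.mem_comap, ← Set.image_pair]
  refine (mem_ideal_span_X_image).trans (forall₂_congr fun m _ => ?_)
  simp only [Set.mem_insert_iff, Set.mem_singleton_iff, exists_eq_or_imp, exists_eq_left]
  omega

theorem center_le_Q (n : ℕ+) : center k n ≤ Q k := by
  refine fun f hf => mem_Q_iff.mpr fun m hm => ?_
  have hexcess := coe_le_excess_iff.mp (mem_center_iff.mp hf) m hm
  omega

theorem exists_le_center {J : Ideal (R k)} (hfg : J.FG) (hJ : J ≤ Q k) :
    ∃ n, J ≤ center k n := by
  classical
  obtain ⟨s, rfl⟩ := hfg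
  have hinj : Function.Injective Var.t := fun _ _ => Var.t.inj
  obtain ⟨n, hn⟩ := Infinite.exists_notMem_finset
    ((s.biUnion fun f => (f : MvPolynomial Var k).vars).preimage Var.t hinj.injOn)
  refine ⟨n, Ideal.span_le.mpr fun f hf => mem_center_iff.mpr (coe_le_excess_iff.mpr ?_)⟩
  intro m hm
  have ht : m (Var.t n) = 0 := by
    by_contra hne
    exact hn (Finset.mem_preimage.mpr (Finset.mem_biUnion.mpr
      ⟨f, hf, (mem_vars_iff_mem_support _).mpr ⟨m, hm, by simpa using hne⟩⟩))
  have hyz := mem_Q_iff.mp (hJ (Ideal.subset_span hf)) m hm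
  omega

theorem C_yR_mem_QRX : Polynomial.C (yR k) ∈ QRX k :=
  Ideal.mem_map_of_mem _ (Ideal.mem_comap.mpr (Ideal.subset_span (Set.mem_insert _ _)))

theorem isTIdeal_QRX : StarIdeals.IsTIdeal (StarIdeals.frac (D := (R k)[X]) (QRX k)) := by
  refine StarIdeals.isTIdeal_of_fg_le_isDivisorial (fun hbot => ?_) fun J hfg hJ => ?_
  · have hy := C_yR_mem_QRX (k := k)
    rw [hbot, Ideal.mem_bot, Polynomial.C_eq_zero] at hy
    exact yR_ne_zero hy
  · obtain ⟨J₀, hfg₀, hJ₀, hJJ₀⟩ := StarIdeals.exists_fg_le_map Polynomial.C hfg hJ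
    obtain ⟨n, hn⟩ := exists_le_center hfg₀ hJ₀
    exact ⟨_, isDivisorial_map_C_center n, hJJ₀.trans (Ideal.map_mono hn),
      Ideal.map_mono (center_le_Q n)⟩

theorem QRX_ne_top : QRX k ≠ ⊤ := by
  intro htop
  have hone : (1 : R k) ∈ Q k := by
    simpa using Ideal.mem_map_C_iff.mp ((Ideal.eq_top_iff_one _).mp htop) 0
  simpa using mem_Q_iff.mp hone 0 (by simp)

theorem P_le_QRX : P k ≤ QRX k := by
  intro g hg
  have hdvd := StarIdeals.map_dvd_map_of_prime prime_map_linearPoly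
    (by rw [natDegree_linearPoly]; exact one_ne_zero) (Ideal.mem_span_singleton.mp hg)
  rw [map_linearPoly] at hdvd
  have hgyz := Ideal.mem_of_dvd
    (I := (Ideal.span {X Var.y, X Var.z}).map (Polynomial.C (R := MvPolynomial Var k))) hdvd
    (add_mem (Ideal.mem_map_of_mem _ (Ideal.subset_span (by simp)))
      (Ideal.mul_mem_right _ _ (Ideal.mem_map_of_mem _ (Ideal.subset_span (by simp)))))
  refine Ideal.mem_map_C_iff.mpr fun i => ?_
  simpa only [Q, Ideal.mem_comap, Polynomial.coeff_map] using Ideal.mem_map_C_iff.mp hgyz i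

theorem P_lt_QRX : P k < QRX k := by
  refine lt_of_le_not_ge P_le_QRX fun hle => yR_ne_zero (k := k) ?_
  rw [← Ideal.mem_bot, ← isUpperToZero_P.2.2]
  exact hle C_yR_mem_QRX

end TIdeal

end MonomialExample

theorem mainTheorem1 (k : Type*) [Field k] :
    StarIdeals.IsCompletelyIntegrallyClosed (MonomialExample.R k) ∧
    StarIdeals.IsCompletelyIntegrallyClosed (Polynomial (MonomialExample.R k)) ∧
    StarIdeals.IsUpperToZero (D := MonomialExample.R k) (MonomialExample.P k) ∧
    StarIdeals.IsVInvertible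
      (StarIdeals.frac (D := Polynomial (MonomialExample.R k)) (MonomialExample.P k)) ∧
    StarIdeals.IsMaximalDivisorial (D := Polynomial (MonomialExample.R k)) (MonomialExample.P k) ∧
    ¬ StarIdeals.IsTMaximal (D := Polynomial (MonomialExample.R k)) (MonomialExample.P k) ∧
    MonomialExample.QRX k ≠ ⊤ ∧
    StarIdeals.IsTIdeal
      (StarIdeals.frac (D := Polynomial (MonomialExample.R k)) (MonomialExample.QRX k)) ∧
    MonomialExample.P k < MonomialExample.QRX k := by
  have hR := MonomialExample.isCompletelyIntegrallyClosed_R (k := k)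
  have hP := MonomialExample.isUpperToZero_P (k := k)
  have hdiv := MonomialExample.isDivisorial_P (k := k)
  have hinv := hR.polynomial.isVInvertible hdiv.1
  have hlt := MonomialExample.P_lt_QRX (k := k)
  have hQtop := MonomialExample.QRX_ne_top (k := k)
  have hQt := MonomialExample.isTIdeal_QRX (k := k)
  exact ⟨hR, hR.polynomial, hP, hinv, hinv.isMaximalDivisorial hP.1 hdiv,
    fun hmax => hlt.not_ge (hmax.2 ⟨hQtop, hQt⟩ hlt.le), hQtop, hQt, hlt⟩
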